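/- A groupoid is a set with one binary operation, written $xy$. A clone on a set is a set of finitary operations that contains all projections and is closed under composition; it is minimal if it is an atom of the lattice of all clones on that set, i.e. it is not the clone of projections and its only proper subclone is the clone of projections. The clone of a groupoid is the clone generated by its operation, and the clone of a variety is the clone of its countably generated free groupoid. The dual of a groupoid $(A;f)$ is $(A;f^d)$ with $f^d(x,y)=f(y,x)$, and the dual $\mathcal V^d$ of a variety $\mathcal V$ consists of the duals of its members. Write $\overleftarrow{x\cdot y_1\cdots y_n}$ for the left-associated product $(\cdots((xy_1)y_2)\cdots)y_n$ and $xy^n$ for $(\cdots((xy)y)\cdots)y$ with $n$ factors $y$. Consider the following varieties of groupoids: - $\mathcal A$, defined by $x(y(zu))\approx x((yz)u)$; - $\mathcal B$, defined by $xx\approx x$ and $x(xy)\approx x(yx)\approx (xy)x\approx (xy)y\approx (xy)(yx)\approx xy$; - $\mathcal C_p$ for a prime $p$, defined by $xx\approx x$, $x(yz)\approx xy$, $(xy)z\approx (xz)y$, $xy^p\approx x$; - $\mathcal D$, defined by $x(yx)\approx (xy)x\approx (xy)y\approx (xy)(yx)\approx xy$ and $x\cdot\overleftarrow{x\cdot y_1\cdots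 y_n}\approx x$ for all $n\ge 0$; - the variety of rectangular bands, i.e. of semigroups satisfying $xx\approx x$ and $xyx\approx x$. **Theorem.** Let $\mathcal V$ be a variety of idempotent groupoids (that is, $\mathcal V$ satisfies $xx\approx x$) that is a subvariety of $\mathcal A$ and has a minimal clone. Then $\mathcal V$ or its dual $\mathcal V^d$ is a subvariety of $\mathcal B$, of $\mathcal C_p$ for some prime $p$, of $\mathcal D$, or of the variety of rectangular bands. -/

import Mathlib

universe u

/-! ## Clones on a set -/

/-- An `(n + 1)`-ary operation on `A`. All operations have positive arity. -/
abbrev Operation (A : Type u) (n : ℕ) : Type u := (Fin (n + 1) → A) → A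

/-- A clone on `A`: a set of finitary operations on `A` (of positive arity) that contains all
projections and is closed under composition. `ops n` is the set of its `(n + 1)`-ary members. -/
@[ext]
structure OperationClone (A : Type u) where
  ops : ∀ n : ℕ, Set (Operation A n)
  proj_mem : ∀ (n : ℕ) (i : Fin (n + 1)), (fun v => v i) ∈ ops n
  comp_mem : ∀ (n m : ℕ) (f : Operation A n) (g : Fin (n + 1) → Operation A m),
    f ∈ ops n → (∀ i, g i ∈ ops m) → (fun v => f fun i => g i v) ∈ ops m

namespace OperationClone

variable {A : Type u}

/-- Clones on `A` are ordered by inclusion. -/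
instance : PartialOrder (OperationClone A) where
  le C D := ∀ n, C.ops n ⊆ D.ops n
  le_refl _ _ := subset_rfl
  le_trans _ _ _ h k n := (h n).trans (k n)
  le_antisymm _ _ h k := OperationClone.ext (funext fun n => (h n).antisymm (k n))

/-- The trivial clone, consisting of the projections, is the least clone. -/
instance : OrderBot (OperationClone A) where
  bot :=
    { ops := fun n => Set.range fun (i : Fin (n + 1)) (v : Fin (n + 1) → A) => v i
      proj_mem := fun _ i => ⟨i, rfl⟩
      comp_mem := by
        rintro n m _ g ⟨i, rfl⟩ hg
        exact hg i }
  bot_le C n := by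
    rintro _ ⟨i, rfl⟩
    exact C.proj_mem n i

/-- The clone `[f]` generated by an operation `f`: the intersection of all clones containing it. -/
def generate {n : ℕ} (f : Operation A n) : OperationClone A where
  ops m := {h | ∀ C : OperationClone A, f ∈ C.ops n → h ∈ C.ops m}
  proj_mem m i C _ := C.proj_mem m i
  comp_mem k m h g hh hg C hC := C.comp_mem k m h g (hh C hC) fun i => hg i C hC

/-- A minimal clone is an atom of the lattice of clones on `A`. -/
def IsMinimal (C : OperationClone A) : Prop := IsAtom C

end OperationClone

/-- The clone of the groupoid `A`, generated by its basic operation. -/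
def groupoidClone (A : Type u) [Mul A] : OperationClone A :=
  OperationClone.generate (n := 1) fun v => v 0 * v 1

/-! ## Varieties of groupoids -/

/-- Groupoid terms in the variables `x₀, x₁, x₂, …`. -/
abbrev GroupoidTerm : Type := FreeMagma ℕ

/-- An identity `s ≈ t` between groupoid terms, represented by the pair `(s, t)`. -/
abbrev GroupoidIdentity : Type := GroupoidTerm × GroupoidTerm

/-- The groupoid `A` satisfies the identity `e`: both sides agree under every assignment. -/
def Satisfies (A : Type u) [Mul A] (e : GroupoidIdentity) : Prop :=
  ∀ v : ℕ → A, FreeMagma.lift v e.1 = FreeMagma.lift v e.2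

/-- A variety of groupoids: a class of groupoids defined by some set of identities. -/
structure GroupoidVariety where
  Mem : ∀ (A : Type u) [Mul A], Prop
  equational : ∃ E : Set GroupoidIdentity, ∀ (A : Type u) [Mul A],
    Mem A ↔ ∀ e ∈ E, Satisfies A e

/-- The mirror image of a term: all products are reversed. -/
def dualTerm : GroupoidTerm → GroupoidTerm
  | FreeMagma.of i => FreeMagma.of i
  | FreeMagma.mul s t => FreeMagma.mul (dualTerm t) (dualTerm s)

/-- The operation `(a, b) ↦ b a` on a groupoid `A`. -/
abbrev dualMul (A : Type u) [Mul A] : Mul A := ⟨fun a b => b * a⟩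

theorem lift_dualMul (A : Type u) [Mul A] (v : ℕ → A) (t : GroupoidTerm) :
    @FreeMagma.lift ℕ A (dualMul A) v t = FreeMagma.lift v (dualTerm t) := by
  induction t with
  | of i => rfl
  | mul s t hs ht =>
    change @FreeMagma.lift ℕ A (dualMul A) v t * @FreeMagma.lift ℕ A (dualMul A) v s =
      FreeMagma.lift v (dualTerm t) * FreeMagma.lift v (dualTerm s)
    rw [hs, ht]

namespace GroupoidVariety

/-- The variety defined by a set of identities. -/
def ofIdentities (E : Set GroupoidIdentity) : GroupoidVariety.{u} where
  Mem A _ := ∀ e ∈ E, Satisfies A e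
  equational := ⟨E, fun _ _ => Iff.rfl⟩

/-- `V ≤ W`: the variety `V` is a subvariety of `W`. -/
instance : LE GroupoidVariety.{u} where
  le V W := ∀ (A : Type u) [Mul A], V.Mem A → W.Mem A

/-- The dual variety: a groupoid `(A; f)` belongs to it iff its dual `(A; fᵈ)`, where
`fᵈ (a, b) = f (b, a)`, belongs to `V`. -/
def dual (V : GroupoidVariety.{u}) : GroupoidVariety.{u} where
  Mem A _ := @Mem V A (dualMul A)
  equational := by
    obtain ⟨E, hE⟩ := V.equational
    refine ⟨(fun e => (dualTerm e.1, dualTerm e.2)) '' E, fun A _ => ?_⟩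
    rw [@hE A (dualMul A), Set.forall_mem_image]
    simp only [Satisfies, lift_dualMul]

/-- The equational theory of `V`, as a congruence of the absolutely free groupoid on countably
many generators. -/
def theory (V : GroupoidVariety.{u}) : Con GroupoidTerm where
  r s t := ∀ (A : Type u) [Mul A], V.Mem A → Satisfies A (s, t)
  iseqv :=
    { refl := fun _ _ _ _ _ => rfl
      symm := fun h A _ hA v => (h A hA v).symm
      trans := fun h k A _ hA v => (h A hA v).trans (k A hA v) }
  mul' := fun h k A _ hA v => by
    have h₁ := h A hA v
    have h₂ := k A hA v
    dsimp only at h₁ h₂ ⊢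
    rw [map_mul, map_mul, h₁, h₂]

/-- The countably generated free groupoid of `V`: terms modulo the identities of `V`. -/
abbrev FreeGroupoid (V : GroupoidVariety.{u}) : Type := V.theory.Quotient

/-- The clone of a variety is the clone of its countably generated free groupoid. -/
def clone (V : GroupoidVariety.{u}) : OperationClone V.FreeGroupoid :=
  groupoidClone V.FreeGroupoid

/-- The variety has a minimal clone. -/
def HasMinimalClone (V : GroupoidVariety.{u}) : Prop := V.clone.IsMinimal

/-! ### The specific varieties -/

/-- The variable `x`. -/
def x : GroupoidTerm := FreeMagma.of 0
/-- The variable `y`. -/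
def y : GroupoidTerm := FreeMagma.of 1
/-- The variable `z`. -/
def z : GroupoidTerm := FreeMagma.of 2
/-- The variable `u`. -/
def u : GroupoidTerm := FreeMagma.of 3

/-- The left-associated product `(⋯((x₀ x₁) x₂) ⋯) xₙ` of distinct variables; here `x₀` is the
variable `x` and `x₁, …, xₙ` play the role of `y₁, …, yₙ`. -/
def leftProd : ℕ → GroupoidTerm
  | 0 => x
  | n + 1 => leftProd n * FreeMagma.of (n + 1)

/-- The term `x yⁿ = (⋯((x y) y) ⋯) y`, with `n` factors `y`. -/
def xyPow : ℕ → GroupoidTerm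
  | 0 => x
  | n + 1 => xyPow n * y

/-- Idempotent groupoids: `x x ≈ x`. -/
def idempotent : GroupoidVariety.{u} := ofIdentities {(x * x, x)}

/-- The variety `𝒜`, defined by `x (y (z u)) ≈ x ((y z) u)`. -/
def varA : GroupoidVariety.{u} :=
  ofIdentities {(x * (y * (z * u)), x * ((y * z) * u))}

/-- The variety `ℬ`, defined by
`x x ≈ x` and `x (x y) ≈ x (y x) ≈ (x y) x ≈ (x y) y ≈ (x y) (y x) ≈ x y`. -/
def varB : GroupoidVariety.{u} :=
  ofIdentities
    {(x * x, x), (x * (x * y), x * y), (x * (y * x), x * y), ((x * y) * x, x * y),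
      ((x * y) * y, x * y), ((x * y) * (y * x), x * y)}

/-- The variety `𝒞ₚ` of `p`-cyclic groupoids, defined by
`x x ≈ x`, `x (y z) ≈ x y`, `(x y) z ≈ (x z) y` and `x yᵖ ≈ x`. -/
def varC (p : ℕ) : GroupoidVariety.{u} :=
  ofIdentities
    {(x * x, x), (x * (y * z), x * y), ((x * y) * z, (x * z) * y), (xyPow p, x)}

/-- The variety `𝒟`, defined by `x (y x) ≈ (x y) x ≈ (x y) y ≈ (x y) (y x) ≈ x y` and
`x ((⋯(x y₁) ⋯) yₙ) ≈ x` for all `n ≥ 0`. -/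
def varD : GroupoidVariety.{u} :=
  ofIdentities
    ({(x * (y * x), x * y), ((x * y) * x, x * y), ((x * y) * y, x * y),
      ((x * y) * (y * x), x * y)} ∪ Set.range fun n : ℕ => (x * leftProd n, x))

/-- The variety of rectangular bands: idempotent semigroups satisfying `x y x ≈ x`. -/
def rectangularBands : GroupoidVariety.{u} :=
  ofIdentities {((x * y) * z, x * (y * z)), (x * x, x), ((x * y) * x, x)}

end GroupoidVariety

/-! ## Minimal clones of groupoids -/

section MinimalClone

variable {F : Type*} [Mul F]

/-! A variety and its countably generated free groupoid `F` satisfy the same identities, so only `F`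
has to be classified. In `F` a product `s * a` depends on `a` only through its image in a band `R`,
a quotient of `F`: the identity of `𝒜` makes the quotient associative (`exists_band_action`).
Minimality says that every term operation other than a projection generates the multiplication. So
if a list of binary operations contains the projections and is closed under such a term, the
multiplication is on the list (`binary_dichotomy`, `ternary_dichotomy`). Applied to `xyx`, this
makes `R` left zero, right zero, rectangular, or left or right regular (`band_alternatives`). If `R`
is left zero, then `x(yz) ≈ xy`, and the study of the terms `xyᵏ` leads to `𝒞ₚ` or `𝒟`. If `R` is
right zero or rectangular, `F` is itself a rectangular band. If `R` is regular and neither left nor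
right zero, `x(xy)` or `x(yx)` satisfies the identities of `ℬ`, and the multiplication is that term
or its dual; this is the only case that needs the dual variety. -/

theorem mul_mem_groupoidClone : (fun v : Fin 2 → F => v 0 * v 1) ∈ (groupoidClone F).ops 1 :=
  fun _ h => h

theorem mul_mem_ops {n : ℕ} {f g : Operation F n} (hf : f ∈ (groupoidClone F).ops n)
    (hg : g ∈ (groupoidClone F).ops n) : (fun v => f v * g v) ∈ (groupoidClone F).ops n := by
  have := (groupoidClone F).comp_mem 1 n (fun v : Fin 2 → F => v 0 * v 1) ![f, g]
    mul_mem_groupoidClone (by intro i; fin_cases i <;> assumption)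
  simpa using this

theorem iterate_mul_mem_ops {n : ℕ} {f g : Operation F n} (hf : f ∈ (groupoidClone F).ops n)
    (hg : g ∈ (groupoidClone F).ops n) (k : ℕ) :
    (fun v => (· * g v)^[k] (f v)) ∈ (groupoidClone F).ops n := by
  induction k with
  | zero => exact hf
  | succ k ih =>
    simp only [Function.iterate_succ_apply']
    exact mul_mem_ops ih hg

theorem generate_le_iff {A : Type*} {n : ℕ} {f : Operation A n} {C : OperationClone A} :
    OperationClone.generate f ≤ C ↔ f ∈ C.ops n :=
  ⟨fun h => h n fun _ hD => hD, fun h _ _ hg => hg C h⟩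

theorem mul_ne_projection (hmin : (groupoidClone F).IsMinimal) (i : Fin 2) :
    (fun v : Fin 2 → F => v 0 * v 1) ≠ fun v => v i := by
  intro h
  refine hmin.1 (le_antisymm (generate_le_iff.2 ?_) bot_le)
  rw [h]
  exact OperationClone.proj_mem _ _ _

theorem not_mul_eq_left (hmin : (groupoidClone F).IsMinimal) : ¬ ∀ a b : F, a * b = a :=
  fun h => mul_ne_projection hmin 0 (funext fun _ => h _ _)

theorem not_mul_eq_right (hmin : (groupoidClone F).IsMinimal) : ¬ ∀ a b : F, a * b = b :=
  fun h => mul_ne_projection hmin 1 (funext fun _ => h _ _)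

/-- The operations preserving a set of binary operations form a clone. -/
def preservingClone {A : Type*} (P : (A → A → A) → Prop) : OperationClone A where
  ops n := {h | ∀ q : Fin (n + 1) → A → A → A, (∀ i, P (q i)) → P fun a b => h fun i => q i a b}
  proj_mem _ i _ hq := hq i
  comp_mem _ _ _ g hf hg q hq := hf (fun i a b => g i fun j => q j a b) fun i => hg i q hq

/-- In a minimal clone, a set of binary operations that contains the projections and is closed
under some nontrivial operation contains the multiplication. -/
theorem mul_mem_of_preserved (hmin : (groupoidClone F).IsMinimal) {n : ℕ} {g : Operation F n}
    (hg : g ∈ (groupoidClone F).ops n) (hne : ∀ i, g ≠ fun v => v i)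
    {P : (F → F → F) → Prop} (hfst : P fun a _ => a) (hsnd : P fun _ b => b)
    (hP : ∀ q : Fin (n + 1) → F → F → F, (∀ i, P (q i)) → P fun a b => g fun i => q i a b) :
    P fun a b => a * b := by
  have hle : OperationClone.generate g ≤ groupoidClone F := generate_le_iff.2 hg
  have heq : OperationClone.generate g = groupoidClone F := by
    refine (hmin.le_iff.1 hle).resolve_left fun h => ?_
    have hmem : g ∈ (OperationClone.generate g).ops n := fun _ hD => hD
    rw [h] at hmem
    obtain ⟨i, hi⟩ := hmem
    exact hne i hi.symm
  have hmul := mul_mem_groupoidClone (F := F)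
  rw [← heq] at hmul
  refine hmul (preservingClone P) hP ![fun a _ => a, fun _ b => b] fun i => ?_
  fin_cases i
  · exact hfst
  · exact hsnd

/-- In applications `P` is a short list of operations closed under `g`; the conclusion then
identifies the multiplication. -/
theorem binary_dichotomy (hmin : (groupoidClone F).IsMinimal) (g : F → F → F)
    (hg : (fun v : Fin 2 → F => g (v 0) (v 1)) ∈ (groupoidClone F).ops 1) :
    (∀ a b, g a b = a) ∨ (∀ a b, g a b = b) ∨
      ∀ P : (F → F → F) → Prop, P (fun a _ => a) → P (fun _ b => b) →
        (∀ p q, P p → P q → P fun a b => g (p a b) (q a b)) → P fun a b => a * b := by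
  by_cases h : ∃ i, (fun v : Fin 2 → F => g (v 0) (v 1)) = fun v => v i
  · obtain ⟨i, hi⟩ := h
    fin_cases i
    · exact Or.inl fun a b => congrFun hi ![a, b]
    · exact Or.inr (Or.inl fun a b => congrFun hi ![a, b])
  · push Not at h
    exact Or.inr (Or.inr fun P h₀ h₁ hP =>
      mul_mem_of_preserved hmin hg h h₀ h₁ fun q hq => hP _ _ (hq 0) (hq 1))

theorem ternary_dichotomy (hmin : (groupoidClone F).IsMinimal) (g : F → F → F → F)
    (hg : (fun v : Fin 3 → F => g (v 0) (v 1) (v 2)) ∈ (groupoidClone F).ops 2) :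
    (∀ a b c, g a b c = a) ∨ (∀ a b c, g a b c = b) ∨ (∀ a b c, g a b c = c) ∨
      ∀ P : (F → F → F) → Prop, P (fun a _ => a) → P (fun _ b => b) →
        (∀ p q r, P p → P q → P r → P fun a b => g (p a b) (q a b) (r a b)) →
          P fun a b => a * b := by
  by_cases h : ∃ i, (fun v : Fin 3 → F => g (v 0) (v 1) (v 2)) = fun v => v i
  · obtain ⟨i, hi⟩ := h
    fin_cases i
    · exact Or.inl fun a b c => congrFun hi ![a, b, c]
    · exact Or.inr (Or.inl fun a b c => congrFun hi ![a, b, c])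
    · exact Or.inr (Or.inr (Or.inl fun a b c => congrFun hi ![a, b, c]))
  · push Not at h
    exact Or.inr (Or.inr (Or.inr fun P h₀ h₁ hP =>
      mul_mem_of_preserved hmin hg h h₀ h₁ fun q hq => hP _ _ _ (hq 0) (hq 1) (hq 2)))

/-- Ternary operations of a minimal clone all of whose identifications of variables are the first
projection are the first projection. -/
theorem eq_left_of_semiprojection (hmin : (groupoidClone F).IsMinimal) (g : F → F → F → F)
    (hg : (fun v : Fin 3 → F => g (v 0) (v 1) (v 2)) ∈ (groupoidClone F).ops 2)
    (h₁ : ∀ a b, g a a b = a) (h₂ : ∀ a b, g a b a = a) (h₃ : ∀ a b, g a b b = a) (a b c : F) :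
    g a b c = a := by
  obtain h | h | h | h := ternary_dichotomy hmin g hg
  · exact h a b c
  · have (a b : F) : a = b := by rw [← h₂ a b, h]
    exact this _ _
  · have (a b : F) : a = b := by rw [← h₁ a b, h]
    exact this _ _
  · exfalso
    -- Among three projections of two variables two coincide, so `g` applied to them is again a
    -- projection.
    have := h (fun p => (∀ a b, p a b = a) ∨ ∀ a b, p a b = b) (Or.inl fun _ _ => rfl)
      (Or.inr fun _ _ => rfl) (by
        rintro p q r (hp | hp) (hq | hq) (hr | hr) <;> simp [hp, hq, hr, h₁, h₂, h₃])
    exact this.elim (not_mul_eq_left hmin) (not_mul_eq_right hmin)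

end MinimalClone

/-! ## The band acting on an idempotent groupoid in `𝒜` -/

section Band

variable {F : Type u} [Mul F]

/-- The congruence identifying elements that act in the same way on the right, inside every
product. -/
def rightActionCon (hA : ∀ a b c d : F, a * (b * (c * d)) = a * ((b * c) * d)) : Con F where
  r a b := ∀ s, s * a = s * b ∧ ∀ w, s * (a * w) = s * (b * w)
  iseqv :=
    { refl := fun _ _ => ⟨rfl, fun _ => rfl⟩
      symm := fun h s => ⟨(h s).1.symm, fun w => ((h s).2 w).symm⟩
      trans := fun h k s => ⟨(h s).1.trans (k s).1, fun w => ((h s).2 w).trans ((k s).2 w)⟩ }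
  mul' := by
    intro a b c d h k s
    -- The clause with `w` in the relation is what lets the left factor of a product be replaced.
    refine ⟨by rw [(h s).2, (k b).1], fun w => ?_⟩
    rw [← hA, ← hA, (h s).2, (k b).2]

theorem exists_band_action (hid : ∀ a : F, a * a = a)
    (hA : ∀ a b c d : F, a * (b * (c * d)) = a * ((b * c) * d)) :
    ∃ (R : Type u) (_ : Semigroup R) (π : F → R), Function.Surjective π ∧
      (∀ a b, π (a * b) = π a * π b) ∧ (∀ r : R, r * r = r) ∧
      ∀ s a b, π a = π b → s * a = s * b := by
  let c := rightActionCon hA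
  refine ⟨c.Quotient, { mul_assoc := ?_ }, fun a => (a : c.Quotient), fun r => Con.induction_on r fun a => ⟨a, rfl⟩,
    fun _ _ => rfl, ?_, fun s a b h => (((Con.eq c).1 h) s).1⟩
  · intro r s t
    induction r, s using Con.induction_on₂ with | _ r s
    induction t using Con.induction_on with | _ t
    refine (Con.eq c).2 fun a => ⟨(hA _ _ _ _).symm, fun w => ?_⟩
    rw [← hA, ← hA, ← hA, ← hA r s t w]
  · intro r
    induction r using Con.induction_on with | _ r
    exact congrArg _ (hid r)

end Band

/-! ### Types of the acting band; right zero and rectangular bands -/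

section Cases

variable {F R : Type*} [Mul F] [Semigroup R] {π : F → R}

/-- In a band the operations `x`, `y`, `xyx`, `yxy` are closed under `xyx`. If that term is not a
projection in `F`, the multiplication of `R` is therefore one of these four. -/
theorem band_alternatives (hmin : (groupoidClone F).IsMinimal) (hsurj : Function.Surjective π)
    (hπ : ∀ a b, π (a * b) = π a * π b) (hR : ∀ r : R, r * r = r) :
    (∀ r s : R, r * s = r) ∨ (∀ r s : R, r * s = s) ∨
      ((∀ a b : F, a * b * a = a) ∧ ∀ r s : R, r * s * r = r) ∨
      (∀ r s : R, r * s * r = r * s) ∨ (∀ r s : R, s * r * s = r * s) := by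
  have hR' (r s : R) : r * (r * s) = r * s := by rw [← mul_assoc, hR]
  have lift₂ {p q : R → R → R} (h : ∀ a b, p (π a) (π b) = q (π a) (π b)) (r s : R) :
      p r s = q r s := by
    obtain ⟨a, rfl⟩ := hsurj r
    obtain ⟨b, rfl⟩ := hsurj s
    exact h a b
  obtain h | h | h := binary_dichotomy hmin (fun a b => a * b * a)
    (mul_mem_ops mul_mem_groupoidClone (OperationClone.proj_mem _ 1 0))
  · refine Or.inr (Or.inr (Or.inl ⟨h, lift₂ fun a b => ?_⟩))
    rw [← hπ, ← hπ, h]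
  · have key : ∀ r s : R, r * s * r = s := lift₂ fun a b => by rw [← hπ, ← hπ, h]
    refine Or.inr (Or.inl fun r s => ?_)
    calc r * s = r * (r * s * r) := by rw [key]
      _ = r * s * r := by rw [mul_assoc, hR']
      _ = s := key r s
  · have := h (fun p => (∀ a b, π (p a b) = π a) ∨ (∀ a b, π (p a b) = π b) ∨
      (∀ a b, π (p a b) = π a * π b * π a) ∨ (∀ a b, π (p a b) = π b * π a * π b))
      (Or.inl fun _ _ => rfl) (Or.inr (Or.inl fun _ _ => rfl)) (by
        have h₃ (r s : R) : r * (s * (r * s)) = r * s := by rw [← mul_assoc, hR]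
        rintro p q (hp | hp | hp | hp) (hq | hq | hq | hq) <;>
          simp [hπ, hp, hq, mul_assoc, hR, hR', h₃])
    obtain h | h | h | h := this
    · exact Or.inl (lift₂ fun a b => by rw [← hπ, h])
    · exact Or.inr (Or.inl (lift₂ fun a b => by rw [← hπ, h]))
    · exact Or.inr (Or.inr (Or.inr (Or.inl (lift₂ fun a b => by rw [← h, hπ]))))
    · exact Or.inr (Or.inr (Or.inr (Or.inr (lift₂ fun a b => by rw [← h, hπ]))))

theorem rectangular_of_right_zero (hmin : (groupoidClone F).IsMinimal)
    (hid : ∀ a : F, a * a = a) (hπ : ∀ a b, π (a * b) = π a * π b)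
    (hact : ∀ s a b, π a = π b → s * a = s * b) (hR : ∀ r s : R, r * s = s) :
    (∀ a b c : F, a * b * c = a * (b * c)) ∧ ∀ a b : F, a * b * a = a := by
  have hlast (s a b : F) : s * (a * b) = s * b := hact _ _ _ (by rw [hπ, hR])
  have hend (a b : F) : a * b * b = a * b := by rw [← hlast _ a b, hid]
  have habs : ∀ a b : F, a * b * a = a := by
    obtain h | h | h := binary_dichotomy hmin (fun a b => a * b * a)
      (mul_mem_ops mul_mem_groupoidClone (OperationClone.proj_mem _ 1 0))
    · exact h
    · exfalso
      refine not_mul_eq_right hmin fun a b => ?_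
      have h₁ := h a (a * b)
      rw [hlast, h] at h₁
      exact h₁.symm
    · exfalso
      -- As a right factor `e k a b` acts like `a`, so the operations `e k a b` and `e k b a` are
      -- closed under `xyx`.
      let e (k : ℕ) (a b : F) : F := (fun s => s * b * a)^[k] a
      have he (k : ℕ) (a b : F) : π (e k a b) = π a := by
        cases k with
        | zero => rfl
        | succ k => simp only [e, Function.iterate_succ_apply', hπ, hR]
      have he' (k : ℕ) (a b s : F) : s * e k a b = s * a := hact _ _ _ (he k a b)
      have hself (k : ℕ) (a b : F) : e k a b * a = e k a b := by rw [← he' k a b, hid]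
      have := h (fun p => (∃ k, ∀ a b, p a b = e k a b) ∨ ∃ k, ∀ a b, p a b = e k b a)
        (Or.inl ⟨0, fun _ _ => rfl⟩) (Or.inr ⟨0, fun _ _ => rfl⟩) (by
          rintro p q (⟨k, hp⟩ | ⟨k, hp⟩) (⟨j, hq⟩ | ⟨j, hq⟩)
          · exact Or.inl ⟨k, fun a b => by simp [hp, hq, he', hself]⟩
          · exact Or.inl ⟨k + 1, fun a b => by
              simp only [hp, hq, he', e, Function.iterate_succ_apply']⟩
          · exact Or.inr ⟨k + 1, fun a b => by
              simp only [hp, hq, he', e, Function.iterate_succ_apply']⟩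
          · exact Or.inr ⟨k, fun a b => by simp [hp, hq, he', hself]⟩)
      obtain ⟨k, hk⟩ | ⟨k, hk⟩ := this
      · refine not_mul_eq_left hmin fun a b => ?_
        have h₁ : a * b * a = a * b := by
          have := hself k a b
          rwa [← hk] at this
        rw [← hlast a a b, ← h₁, hlast, hid]
      · have h₁ (a b : F) : b * a * b = a * b := by
          -- Right factors act through their last letter, so `e k b (b * a)` collapses to `e k b a`,
          -- which is `a * b`.
          have := hk (b * a) b
          simp only [e, hlast] at this
          rw [this]
          exact (hk a b).symm
        refine not_mul_eq_right hmin fun a b => ?_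
        have h₂ := h₁ (a * b) b
        rw [hlast, hid, hid, hend] at h₂
        exact h₂.symm
  have habs₃ := eq_left_of_semiprojection hmin (fun a b c => a * b * c * a)
    (mul_mem_ops (mul_mem_ops (mul_mem_ops (OperationClone.proj_mem _ 2 0)
      (OperationClone.proj_mem _ 2 1)) (OperationClone.proj_mem _ 2 2))
      (OperationClone.proj_mem _ 2 0))
    (fun a b => by simp only [hid, habs]) (fun a b => by simp only [habs, hid])
    (fun a b => by simp only [hend, habs])
  refine ⟨fun a b c => ?_, habs⟩
  have h₁ := habs (a * b * c) a
  rw [habs₃, hlast] at h₁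
  rw [hlast, h₁]

theorem rectangular_of_rectangular (hmin : (groupoidClone F).IsMinimal)
    (hsurj : Function.Surjective π)
    (hπ : ∀ a b, π (a * b) = π a * π b)
    (hact : ∀ s a b, π a = π b → s * a = s * b) (hR : ∀ r s : R, r * s * r = r)
    (hl : ¬ ∀ r s : R, r * s = r) (hr : ¬ ∀ r s : R, r * s = s)
    (habs : ∀ a b : F, a * b * a = a) (a b c : F) : a * b * c = a * (b * c) := by
  have hR₂ (r s t : R) : r * s * t * r = r := by rw [mul_assoc r, hR]
  have lift₂ {p q : R → R → R} (h : ∀ a b, p (π a) (π b) = q (π a) (π b)) (r s : R) :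
      p r s = q r s := by
    obtain ⟨a, rfl⟩ := hsurj r
    obtain ⟨b, rfl⟩ := hsurj s
    exact h a b
  -- Operations lying over a projection of `R` are closed under `g`. If `g` were not a projection,
  -- the multiplication would lie over one, making `R` left or right zero.
  have key {g : F → F → F → F}
      (hg : (fun v : Fin 3 → F => g (v 0) (v 1) (v 2)) ∈ (groupoidClone F).ops 2)
      (h : ∀ a b c, π (g a b c) = π a) (a b c : F) : g a b c = a := by
    obtain h' | h' | h' | h' := ternary_dichotomy hmin g hg
    · exact h' a b c
    · have h₁ (a b : F) : π a = π b := by rw [← h a b a, h']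
      exact absurd (lift₂ fun a b => by rw [← hπ, h₁]) hl
    · have h₁ (a b : F) : π a = π b := by rw [← h a a b, h']
      exact absurd (lift₂ fun a b => by rw [← hπ, h₁]) hl
    · have := h' (fun p => (∀ a b, π (p a b) = π a) ∨ ∀ a b, π (p a b) = π b)
        (Or.inl fun _ _ => rfl) (Or.inr fun _ _ => rfl) (by
          rintro p q r (hp | hp) _ _ <;> simp [h, hp])
      obtain h₁ | h₁ := this
      · exact absurd (lift₂ fun a b => by rw [← hπ, h₁]) hl
      · exact absurd (lift₂ fun a b => by rw [← hπ, h₁]) hr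
  have hp (i : Fin 3) := OperationClone.proj_mem (groupoidClone F) 2 i
  have h₁ := key (g := fun a b c => a * b * c * a)
    (mul_mem_ops (mul_mem_ops (mul_mem_ops (hp 0) (hp 1)) (hp 2)) (hp 0))
    (fun a b c => by simp only [hπ, hR₂]) a b c
  have h₂ := key (g := fun a b c => a * (b * c) * a)
    (mul_mem_ops (mul_mem_ops (hp 0) (mul_mem_ops (hp 1) (hp 2))) (hp 0))
    (fun a b c => by simp only [hπ, hR]) a b c
  have h₃ := habs (a * b * c) a
  have h₄ := habs (a * (b * c)) a
  rw [h₁] at h₃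
  rw [h₂] at h₄
  rw [← h₃, ← h₄]
  exact hact _ _ _ (by simp only [hπ, mul_assoc])

/-! ### Regular bands and the variety `ℬ` -/

/-- The identities defining `ℬ`, apart from idempotence. -/
def SatisfiesB {F : Type*} (m : F → F → F) : Prop :=
  ∀ a b, m a (m a b) = m a b ∧ m a (m b a) = m a b ∧ m (m a b) a = m a b ∧
    m (m a b) b = m a b ∧ m (m a b) (m b a) = m a b

/-- The identities of `ℬ` close the list `x`, `y`, `g(x, y)`, `g(y, x)` under `g`. -/
theorem satisfiesB_of_term {F : Type*} [Mul F] (hmin : (groupoidClone F).IsMinimal)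
    {g : F → F → F} (hg : (fun v : Fin 2 → F => g (v 0) (v 1)) ∈ (groupoidClone F).ops 1)
    (hid : ∀ a, g a a = a) (hB : SatisfiesB g)
    (hl : ¬ ∀ a b, g a b = a) (hr : ¬ ∀ a b, g a b = b) :
    SatisfiesB (fun a b : F => a * b) ∨ SatisfiesB (fun a b : F => b * a) := by
  unfold SatisfiesB at hB
  obtain h | h | h := binary_dichotomy hmin g hg
  · exact absurd h hl
  · exact absurd h hr
  · have := h (fun p => (∀ a b, p a b = a) ∨ (∀ a b, p a b = b) ∨
      (∀ a b, p a b = g a b) ∨ (∀ a b, p a b = g b a))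
      (Or.inl fun _ _ => rfl) (Or.inr (Or.inl fun _ _ => rfl)) (by
        rintro p q (hp | hp | hp | hp) (hq | hq | hq | hq) <;>
          simp [hp, hq, hid, hB])
    obtain h | h | h | h := this
    · exact absurd h (not_mul_eq_left hmin)
    · exact absurd h (not_mul_eq_right hmin)
    · left
      rwa [show (fun a b : F => a * b) = g from funext₂ h]
    · right
      rwa [show (fun a b : F => b * a) = g from funext₂ fun a b => h b a]

theorem satisfiesB_of_left_regular (hmin : (groupoidClone F).IsMinimal)
    (hid : ∀ a : F, a * a = a) (hsurj : Function.Surjective π)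
    (hπ : ∀ a b, π (a * b) = π a * π b) (hidR : ∀ r : R, r * r = r)
    (hact : ∀ s a b, π a = π b → s * a = s * b) (hR : ∀ r s : R, r * s * r = r * s)
    (hl : ¬ ∀ r s : R, r * s = r) (hr : ¬ ∀ r s : R, r * s = s) :
    SatisfiesB (fun a b : F => a * b) ∨ SatisfiesB (fun a b : F => b * a) := by
  have hR₁ (r s : R) : r * (r * s) = r * s := by rw [← mul_assoc, hidR]
  have hR₂ (r s : R) : r * (s * r) = r * s := by rw [← mul_assoc, hR]
  -- The extra left factor turns absorption in `R` into absorption in `F`: if `c` is absorbed by the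
  -- image of `u`, then `u(uc) = uu = u`.
  let g (a b : F) : F := a * (a * b)
  have hπg (a b : F) : π (g a b) = π a * π b := by simp only [g, hπ, hR₁]
  have hg (a b c : F) (h : π a * π b * π c = π a * π b) : g (g a b) c = g a b := by
    have h₁ : g a b * (g a b * c) = g a b * g a b := hact _ _ _ (by rw [hπ, hπg, h])
    exact h₁.trans (hid _)
  refine satisfiesB_of_term hmin (g := g)
    (mul_mem_ops (OperationClone.proj_mem _ 1 0) mul_mem_groupoidClone)
    (fun a => by simp only [g, hid])
    (fun a b => ⟨hact _ _ _ ?_, hact _ _ _ ?_, hg _ _ _ ?_, hg _ _ _ ?_, hg _ _ _ ?_⟩)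
    (fun h => hl (hsurj.forall₂.2 fun a b => by rw [← hπg, h]))
    (fun h => hr (hsurj.forall₂.2 fun a b => by rw [← hπg, h])) <;>
  simp only [hπ, hπg, mul_assoc, hR₁, hR₂, hidR]

theorem satisfiesB_of_right_regular (hmin : (groupoidClone F).IsMinimal)
    (hid : ∀ a : F, a * a = a) (hsurj : Function.Surjective π)
    (hπ : ∀ a b, π (a * b) = π a * π b) (hidR : ∀ r : R, r * r = r)
    (hact : ∀ s a b, π a = π b → s * a = s * b) (hR : ∀ r s : R, s * r * s = r * s)
    (hl : ¬ ∀ r s : R, r * s = r) (hr : ¬ ∀ r s : R, r * s = s) :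
    SatisfiesB (fun a b : F => a * b) ∨ SatisfiesB (fun a b : F => b * a) := by
  have hR₁ (r s : R) : r * (r * s) = r * s := by rw [← mul_assoc, hidR]
  have hR₂ (r s : R) : s * (r * s) = r * s := by rw [← mul_assoc, hR]
  -- Here the order is reversed in `R`, and absorption reads `u(cu) = uu = u`.
  let g (a b : F) : F := a * (b * a)
  have hπg (a b : F) : π (g a b) = π b * π a := by simp only [g, hπ, hR₂]
  have hg (a b c : F) (h : π c * (π b * π a) = π b * π a) : g (g a b) c = g a b := by
    have h₁ : g a b * (c * g a b) = g a b * g a b := hact _ _ _ (by rw [hπ, hπg, h])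
    exact h₁.trans (hid _)
  refine satisfiesB_of_term hmin (g := g)
    (mul_mem_ops (OperationClone.proj_mem _ 1 0)
      (mul_mem_ops (OperationClone.proj_mem _ 1 1) (OperationClone.proj_mem _ 1 0)))
    (fun a => by simp only [g, hid])
    (fun a b => ⟨hact _ _ _ ?_, hact _ _ _ ?_, hg _ _ _ ?_, hg _ _ _ ?_, hg _ _ _ ?_⟩)
    (fun h => hr (hsurj.forall₂.2 fun a b => by rw [← hπg, h]))
    (fun h => hl (hsurj.forall₂.2 fun a b => by rw [← hπg, h])) <;>
  simp only [hπ, hπg, mul_assoc, hR₁, hR₂, hidR]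

/-! ### Left zero bands: powers of right translations -/

/-- If `x(yz) ≈ xy` holds, the right translations are either all idempotent or all of order
dividing a common prime. -/
theorem exists_prime_or_idempotent (hmin : (groupoidClone F).IsMinimal)
    (hid : ∀ a : F, a * a = a) (hleft : ∀ s a b : F, s * (a * b) = s * a) :
    (∃ p : ℕ, p.Prime ∧ ∀ a b : F, (· * b)^[p] a = a) ∨ ∀ a b : F, a * b * b = a * b := by
  let e (k : ℕ) (a b : F) : F := (· * b)^[k] a
  have he (k : ℕ) (a b s : F) : s * e k a b = s * a := by
    induction k with
    | zero => rfl
    | succ k ih =>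
      simp only [e, Function.iterate_succ_apply', hleft]
      exact ih
  have he' (j k : ℕ) (a b s : F) : e j s (e k a b) = e j s a := by
    simp only [e]
    congr 1
    exact funext fun s => he k a b s
  have hself (j k : ℕ) (a b : F) : e j (e k a b) a = e k a b := by
    refine Function.iterate_fixed ?_ j
    rw [← he k a b, hid]
  have hadd (j k : ℕ) (a b : F) : e j (e k a b) b = e (j + k) a b :=
    (Function.iterate_add_apply _ j k a).symm
  have hnl := not_mul_eq_left hmin
  have hmul (a b : F) : e 1 a b = a * b := rfl
  -- The powers `xy^(kj)` and `yx^(kj)` are closed under `xyᵏ`; the mirrored ones cannot be the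
  -- multiplication.
  have dich (k : ℕ) : (∀ a b, e k a b = a) ∨ ∃ j, ∀ a b, a * b = e (k * (j + 1)) a b := by
    obtain h | h | h := binary_dichotomy hmin (e k)
      (iterate_mul_mem_ops (OperationClone.proj_mem _ 1 0) (OperationClone.proj_mem _ 1 1) k)
    · exact Or.inl h
    · exact absurd (fun a b => by have := he k a b a; rwa [h, hid] at this) hnl
    · have := h (fun p => (∃ j, ∀ a b, p a b = e (k * j) a b) ∨
        ∃ j, ∀ a b, p a b = e (k * j) b a) (Or.inl ⟨0, fun _ _ => rfl⟩)
        (Or.inr ⟨0, fun _ _ => rfl⟩) (by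
          rintro p q (⟨i, hp⟩ | ⟨i, hp⟩) (⟨j, hq⟩ | ⟨j, hq⟩)
          · exact Or.inl ⟨i, fun a b => by simp only [hp, hq, he', hself]⟩
          · exact Or.inl ⟨1 + i, fun a b => by simp only [hp, hq, he', hadd, mul_add, mul_one]⟩
          · exact Or.inr ⟨1 + i, fun a b => by simp only [hp, hq, he', hadd, mul_add, mul_one]⟩
          · exact Or.inr ⟨i, fun a b => by simp only [hp, hq, he', hself]⟩)
      obtain ⟨j, hj⟩ | ⟨j, hj⟩ := this
      · cases j with
        | zero => exact absurd hj hnl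
        | succ j => exact Or.inr ⟨j, hj⟩
      · refine absurd (fun a b => ?_) hnl
        rw [← he (k * j) b a a, ← hj, hleft, hid]
  by_cases hex : ∃ k, 0 < k ∧ ∀ a b, e k a b = a
  · left
    classical
    obtain ⟨hpos, hk⟩ := Nat.find_spec hex
    have hlt {m : ℕ} (hm : 0 < m) (h : ∀ a b, e m a b = a) : Nat.find hex ≤ m :=
      Nat.find_min' hex ⟨hm, h⟩
    generalize Nat.find hex = k at hpos hk hlt
    have hk₁ : k ≠ 1 := by
      rintro rfl
      exact hnl hk
    have hp := Nat.minFac_prime hk₁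
    -- Otherwise `xy ≈ xy^(n+1)` with `minFac k` dividing `n + 1`. Right translations are onto, so
    -- `xyⁿ ≈ x` and the least period `k` divides `n`; then `minFac k` divides both `n` and `n + 1`.
    obtain h | ⟨j, hj⟩ := dich k.minFac
    · exact ⟨_, hp, h⟩
    exfalso
    obtain ⟨n, hn⟩ : ∃ n, k.minFac * (j + 1) = n + 1 :=
      Nat.exists_eq_succ_of_ne_zero (mul_pos hp.pos j.succ_pos).ne'
    have hn' (a b : F) : e n a b = a := by
      obtain ⟨c, rfl⟩ : ∃ c, a = c * b := ⟨e (k - 1) a b, by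
        rw [← hmul, hadd, Nat.add_sub_of_le hpos, hk]⟩
      rw [← hmul c b, hadd, ← hn, ← hj, hmul]
    have hmod (a b : F) : e (n % k) a b = a := by
      have h₁ : e (k * (n / k)) a b = a := by
        simp only [e, Function.iterate_mul]
        exact Function.iterate_fixed (hk a b) _
      have := hn' a b
      rwa [← Nat.mod_add_div n k, ← hadd, h₁] at this
    have hdvd : k ∣ n := by
      rw [Nat.dvd_iff_mod_eq_zero]
      by_contra h
      exact absurd (hlt (Nat.pos_of_ne_zero h) hmod) (not_le.2 (Nat.mod_lt _ hpos))
    have h₁ : k.minFac ∣ n := (Nat.minFac_dvd k).trans hdvd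
    have h₂ : k.minFac ∣ n + 1 := ⟨_, hn.symm⟩
    exact hp.one_lt.ne' (Nat.dvd_one.1 ((Nat.dvd_add_right h₁).1 h₂))
  · right
    push Not at hex
    have dich' {k : ℕ} (hk : 0 < k) : ∃ j, ∀ a b, a * b = e (k * (j + 1)) a b :=
      (dich k).resolve_left fun h => by
        obtain ⟨a, b, hab⟩ := hex k hk
        exact hab (h a b)
    -- From `xy ≈ xy^(2j+2)`, positive exponents have period `2j + 1`. Using `dich'` for that period
    -- gives `xy ≈ xy^(2j+1)`, and one more factor `y` gives `xyy ≈ xy`.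
    obtain ⟨j, hj⟩ := dich' two_pos
    obtain ⟨i, hi⟩ := dich' (k := 2 * j + 1) (by omega)
    have hper (m : ℕ) (a b : F) : e (2 * j + 1 + (m + 1)) a b = e (m + 1) a b := by
      rw [← hadd m 1, hmul, hj, hadd]
      congr 1
      omega
    have hper' (i : ℕ) (a b : F) : e ((2 * j + 1) * (i + 1)) a b = e (2 * j + 1) a b := by
      induction i with
      | zero => simp
      | succ i ih =>
        rw [← ih, mul_add _ (i + 1), mul_one, add_comm _ (2 * j + 1)]
        exact hper ((2 * j + 1) * (i + 1) - 1) a b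
    intro a b
    have h₁ : a * b = e (2 * j + 1) a b := by rw [hi, hper']
    calc a * b * b = e 1 (e (2 * j + 1) a b) b := by rw [hmul, ← h₁]
      _ = e (2 * (j + 1)) a b := by rw [hadd]; congr 1; omega
      _ = a * b := (hj a b).symm

/-- The `k`-th power of a right translation is its inverse. The commutator of the translations by
`b` and `c`, applied to `a`, is a term that becomes `a` whenever two variables are identified, so it
is always `a`. -/
theorem right_comm_of_prime (hmin : (groupoidClone F).IsMinimal)
    (hid : ∀ a : F, a * a = a) (hleft : ∀ s a b : F, s * (a * b) = s * a) {k : ℕ}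
    (hk : ∀ a b : F, (· * b)^[k + 1] a = a) (a b c : F) : a * b * c = a * c * b := by
  have hk' (a b : F) : (· * b)^[k] (a * b) = a := hk a b
  have hk'' (a b : F) : (· * b)^[k] a * b = a := by
    rw [← Function.iterate_succ_apply' (f := (· * b)), hk]
  have hself (a b : F) : a * b * a = a * b := by rw [← hleft _ a b, hid]
  have hfix (a b : F) : (· * a)^[k] (a * b) = a * b := Function.iterate_fixed (hself a b) k
  have hfix' (a : F) : (· * a)^[k] a = a := Function.iterate_fixed (f := (· * a)) (hid a) k
  have hp (i : Fin 3) := OperationClone.proj_mem (groupoidClone F) 2 i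
  have key := eq_left_of_semiprojection hmin
    (fun a b c => (· * c)^[k] ((· * b)^[k] (a * b * c)))
    (iterate_mul_mem_ops (iterate_mul_mem_ops
      (mul_mem_ops (mul_mem_ops (hp 0) (hp 1)) (hp 2)) (hp 1) k) (hp 2) k)
    (fun a b => by simp only [hid, hfix, hk'])
    (fun a b => by simp only [hself, hk', hfix'])
    (fun a b => by simp only [hk']) a b c
  have h₁ := congrArg (· * c) key
  simp only [hk''] at h₁
  rw [← h₁, hk'']

end Cases

/-- The alternatives for an idempotent groupoid in `𝒜` with a minimal clone. -/
theorem groupoid_classification {F : Type*} [Mul F] (hmin : (groupoidClone F).IsMinimal)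
    (hid : ∀ a : F, a * a = a)
    (hA : ∀ a b c d : F, a * (b * (c * d)) = a * ((b * c) * d)) :
    SatisfiesB (fun a b : F => a * b) ∨ SatisfiesB (fun a b : F => b * a) ∨
      (∃ p : ℕ, p.Prime ∧ (∀ a b c : F, a * (b * c) = a * b) ∧
        (∀ a b c : F, a * b * c = a * c * b) ∧ ∀ a b : F, (· * b)^[p] a = a) ∨
      ((∀ a b c : F, a * (b * c) = a * b) ∧ ∀ a b : F, a * b * b = a * b) ∨
      ((∀ a b c : F, a * b * c = a * (b * c)) ∧ ∀ a b : F, a * b * a = a) := by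
  obtain ⟨R, _, π, hsurj, hπ, hidR, hact⟩ := exists_band_action hid hA
  by_cases hl : ∀ r s : R, r * s = r
  · have hleft (s a b : F) : s * (a * b) = s * a := hact _ _ _ (by rw [hπ, hl])
    obtain ⟨p, hp, h⟩ | h := exists_prime_or_idempotent hmin hid hleft
    · obtain ⟨k, rfl⟩ := Nat.exists_eq_succ_of_ne_zero hp.ne_zero
      exact Or.inr (Or.inr (Or.inl ⟨_, hp, hleft, right_comm_of_prime hmin hid hleft h, h⟩))
    · exact Or.inr (Or.inr (Or.inr (Or.inl ⟨hleft, h⟩)))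
  by_cases hr : ∀ r s : R, r * s = s
  · exact Or.inr (Or.inr (Or.inr (Or.inr (rectangular_of_right_zero hmin hid hπ hact hr))))
  obtain h | h | ⟨h, h'⟩ | h | h := band_alternatives hmin hsurj hπ hidR
  · exact absurd h hl
  · exact absurd h hr
  · exact Or.inr (Or.inr (Or.inr (Or.inr
      ⟨rectangular_of_rectangular hmin hsurj hπ hact h' hl hr h, h⟩)))
  · exact or_assoc.1 (Or.inl (satisfiesB_of_left_regular hmin hid hsurj hπ hidR hact h hl hr))
  · exact or_assoc.1 (Or.inl (satisfiesB_of_right_regular hmin hid hsurj hπ hidR hact h hl hr))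

/-! ## Identities of a variety and of its free groupoid -/

namespace GroupoidVariety

theorem lift_freeGroupoid (V : GroupoidVariety.{u}) (σ : ℕ → GroupoidTerm) (t : GroupoidTerm) :
    FreeMagma.lift (fun i => (σ i : V.FreeGroupoid)) t = (FreeMagma.lift σ t : GroupoidTerm) := by
  induction t with
  | of i => rfl
  | mul s t hs ht =>
    change FreeMagma.lift (fun i => (σ i : V.FreeGroupoid)) s *
      FreeMagma.lift (fun i => (σ i : V.FreeGroupoid)) t = _
    rw [hs, ht]
    rfl

theorem lift_lift {A : Type*} [Mul A] (v : ℕ → A) (σ : ℕ → GroupoidTerm) (t : GroupoidTerm) :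
    FreeMagma.lift v (FreeMagma.lift σ t) = FreeMagma.lift (fun i => FreeMagma.lift v (σ i)) t := by
  induction t with
  | of i => rfl
  | mul s t hs ht =>
    change FreeMagma.lift v (FreeMagma.lift σ s) * FreeMagma.lift v (FreeMagma.lift σ t) = _
    rw [hs, ht]
    rfl

/-- An identity holds in a variety iff it holds in its countably generated free groupoid. -/
theorem satisfies_freeGroupoid_iff (V : GroupoidVariety.{u}) (e : GroupoidIdentity) :
    Satisfies V.FreeGroupoid e ↔ ∀ (A : Type u) [Mul A], V.Mem A → Satisfies A e := by
  constructor
  · intro h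
    have h₁ := h fun i => (FreeMagma.of i : GroupoidTerm)
    rw [lift_freeGroupoid, lift_freeGroupoid] at h₁
    have h₂ (t : GroupoidTerm) : FreeMagma.lift FreeMagma.of t = t := by
      induction t with
      | of i => rfl
      | mul s t hs ht =>
        change FreeMagma.lift FreeMagma.of s * FreeMagma.lift FreeMagma.of t = s * t
        rw [hs, ht]
    rw [h₂, h₂] at h₁
    exact (Con.eq _).1 h₁
  · intro h v
    obtain ⟨σ, rfl⟩ : ∃ σ : ℕ → GroupoidTerm, v = fun i => (σ i : V.FreeGroupoid) :=
      ⟨fun i => (v i).out, funext fun i => (Quotient.out_eq _).symm⟩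
    rw [lift_freeGroupoid, lift_freeGroupoid]
    refine (Con.eq _).2 fun A _ hA w => ?_
    dsimp only
    rw [lift_lift, lift_lift]
    exact h A hA _

theorem le_ofIdentities_iff (V : GroupoidVariety.{u}) (E : Set GroupoidIdentity) :
    V ≤ ofIdentities E ↔ ∀ e ∈ E, Satisfies V.FreeGroupoid e := by
  simp only [satisfies_freeGroupoid_iff]
  exact ⟨fun h e he A _ hA => h A hA e he, fun h A _ hA e he => h e he A hA⟩

theorem dualTerm_dualTerm (t : GroupoidTerm) : dualTerm (dualTerm t) = t := by
  induction t with
  | of i => rfl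
  | mul s t hs ht =>
    change dualTerm (dualTerm s) * dualTerm (dualTerm t) = s * t
    rw [hs, ht]

/-- Identities of the dual of the free groupoid are mirrored identities of `V`, and mirroring is an
involution. -/
theorem dual_le_ofIdentities (V : GroupoidVariety.{u}) (E : Set GroupoidIdentity)
    (h : ∀ e ∈ E, @Satisfies V.FreeGroupoid (dualMul _) e) : V.dual ≤ ofIdentities E := by
  intro A _ hA e he
  have h₁ : Satisfies V.FreeGroupoid (dualTerm e.1, dualTerm e.2) := fun v => by
    have := h e he v
    rwa [lift_dualMul, lift_dualMul] at this
  have h₂ := (satisfies_freeGroupoid_iff V _).1 h₁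
  intro v
  have h₃ := @h₂ A (dualMul A) hA v
  dsimp only at h₃
  rw [lift_dualMul, lift_dualMul, dualTerm_dualTerm, dualTerm_dualTerm] at h₃
  exact h₃

theorem lift_xyPow {A : Type*} [Mul A] (v : ℕ → A) (k : ℕ) :
    FreeMagma.lift v (xyPow k) = (· * v 1)^[k] (v 0) := by
  induction k with
  | zero => rfl
  | succ k ih =>
    rw [Function.iterate_succ_apply', ← ih]
    rfl

theorem mul_lift_leftProd {A : Type*} [Mul A] (hleft : ∀ a b c : A, a * (b * c) = a * b)
    (v : ℕ → A) (s : A) (k : ℕ) : s * FreeMagma.lift v (leftProd k) = s * v 0 := by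
  induction k with
  | zero => rfl
  | succ k ih => rw [← ih]; exact hleft _ _ _

theorem satisfies_varB_of_satisfiesB {A : Type*} [Mul A] (hid : ∀ a : A, a * a = a)
    (h : SatisfiesB fun a b : A => a * b) :
    ∀ e ∈ ({(x * x, x), (x * (x * y), x * y), (x * (y * x), x * y), ((x * y) * x, x * y),
      ((x * y) * y, x * y), ((x * y) * (y * x), x * y)} : Set GroupoidIdentity),
      Satisfies A e := by
  rintro _ (rfl | rfl | rfl | rfl | rfl | rfl) v
  · exact hid _
  · exact (h _ _).1
  · exact (h _ _).2.1
  · exact (h _ _).2.2.1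
  · exact (h _ _).2.2.2.1
  · exact (h _ _).2.2.2.2

end GroupoidVariety

open GroupoidVariety in
theorem GroupoidVariety.le_or_dual_le_of_minimal (V : GroupoidVariety.{u})
    (hA : V ≤ varA) (hidem : V ≤ idempotent) (hmin : V.HasMinimalClone) :
    V ≤ varB ∨ V.dual ≤ varB ∨ (∃ p : ℕ, p.Prime ∧ V ≤ varC p) ∨ V ≤ varD ∨
      V ≤ rectangularBands := by
  have hid (a : V.FreeGroupoid) : a * a = a :=
    (le_ofIdentities_iff _ _).1 hidem _ rfl fun _ => a
  have hA' (a b c d : V.FreeGroupoid) : a * (b * (c * d)) = a * ((b * c) * d) :=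
    (le_ofIdentities_iff _ _).1 hA _ rfl
      fun | 0 => a | 1 => b | 2 => c | _ => d
  obtain h | h | ⟨p, hp, h₁, h₂, h₃⟩ | ⟨h₁, h₂⟩ | ⟨h₁, h₂⟩ :=
    groupoid_classification hmin hid hA'
  · exact Or.inl ((le_ofIdentities_iff _ _).2 (satisfies_varB_of_satisfiesB hid h))
  · exact Or.inr (Or.inl (dual_le_ofIdentities _ _
      (@satisfies_varB_of_satisfiesB _ (dualMul _) hid h)))
  · refine Or.inr (Or.inr (Or.inl ⟨p, hp, (le_ofIdentities_iff _ _).2 ?_⟩))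
    rintro _ (rfl | rfl | rfl | rfl) v
    · exact hid _
    · exact h₁ _ _ _
    · exact h₂ _ _ _
    · exact (lift_xyPow v p).trans (h₃ _ _)
  · refine Or.inr (Or.inr (Or.inr (Or.inl ((le_ofIdentities_iff _ _).2 ?_))))
    have hself (a b : V.FreeGroupoid) : a * b * a = a * b := by rw [← h₁ _ a b, hid]
    rintro _ ((rfl | rfl | rfl | rfl) | ⟨n, rfl⟩) v
    · exact h₁ _ _ _
    · exact hself _ _
    · exact h₂ _ _
    · exact (h₁ _ _ _).trans (h₂ _ _)
    · exact (mul_lift_leftProd h₁ v _ n).trans (hid _)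
  · refine Or.inr (Or.inr (Or.inr (Or.inr ((le_ofIdentities_iff _ _).2 ?_))))
    rintro _ (rfl | rfl | rfl) v
    · exact h₁ _ _ _
    · exact hid _
    · exact h₂ _ _

theorem theorem2p7 (V : GroupoidVariety.{u})
    (hA : V ≤ GroupoidVariety.varA)
    (hidem : V ≤ GroupoidVariety.idempotent)
    (hmin : V.HasMinimalClone) :
    ∃ U : GroupoidVariety.{u}, (U = V ∨ U = V.dual) ∧
      (U ≤ GroupoidVariety.varB ∨
        (∃ p : ℕ, p.Prime ∧ U ≤ GroupoidVariety.varC p) ∨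
        U ≤ GroupoidVariety.varD ∨
        U ≤ GroupoidVariety.rectangularBands) := by
  obtain h | h | h := V.le_or_dual_le_of_minimal hA hidem hmin
  · exact ⟨V, Or.inl rfl, Or.inl h⟩
  · exact ⟨V.dual, Or.inr rfl, Or.inl h⟩
  · exact ⟨V, Or.inl rfl, Or.inr h⟩
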